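/- Let $n\ge 1$, let $K,M,a>0$ and $M_1\ge 0$ be real with $a\le \frac{K}{M(1+nM_1)}$, and let $f:[-K,K]^n\to[-M,M]^n$ be Lipschitz continuous. Consider the initial value problem $$y'(t)=f(y(t)),\qquad y(0)=0,\qquad t\in[0,a].\tag{IVP}$$ **Notation.** For $R\ge 0$, $\mathbb I[-R,R]^m$ is the set of non-empty closed boxes $\prod_{i=1}^m[\underline{b}_i,\overline{b}_i]\subseteq[-R,R]^m$, ordered by reverse inclusion ($b\sqsubseteq c$ iff $c\subseteq b$); interval matrices are treated as boxes. Functions are ordered pointwise, and $\bigsqcup$ denotes least upper bounds. The width $w(b)$ is $\max_i(\overline b_i-\underline b_i)$, and $d(b,c)=\max_i\max(|\underline b_i-\underline c_i|,|\overline b_i-\overline c_i|)$; for box-valued functions $w$ and $d$ are the suprema of the pointwise values. For an interval matrix, $\|A\|_\infty=\max_i\sum_j\max(|\underline A_{ij}|,|\overline A_{ij}|)$. A box-valued $u$ is interval Lipschitz if $w(u(\alpha))\le L\,w(\alpha)$ for some $L\ge0$ and all $\alpha$. The $\overline L$-derivative $\overline L(f)(x)$, $x\in[-K,K]^n$, is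 the interval matrix whose $i$-th row is the intersection of all boxes $b\subseteq\mathbb R^n$ for which there is a relatively open $O\ni x$ in $[-K,K]^n$ with $f_i(y)-f_i(z)\in\{c\cdot(y-z): c\in b\}$ for all $y,z\in O$ (the row being all of $\mathbb R^n$ if there is no such $b$). Let $\mathcal V^1_f$ be the set of pairs of Scott-continuous maps $v:\mathbb I[-K,K]^n\to\mathbb I[-M,M]^n$, $v':\mathbb I[-K,K]^n\to\mathbb I[-M_1,M_1]^{n\times n}$ such that $f(x)\in v(\alpha)$ and $\overline L(f)(x)\subseteq v'(\alpha)$ whenever $x\in\alpha$. For a partition $Q=(0=q_0<\dots<q_k=a)$, $k\ge1$, put $\Delta_j=q_{j+1}-q_j$ and $|Q|=\max_j\Delta_j$. For $(v,v')\in\mathcal V^1_f$ the second-order Euler enclosure $y=E^2_{(v,v')}(Q):[0,a]\to\mathbb I[-K,K]^n$ is defined in interval arithmetic by $y(0)=\{0\}$ and, for $q_j<x\le q_{j+1}$, $$y(x)=T\Big[y(q_j)+\int_{q_j}^x v(y(q_j))+(t-q_j)\,(v'\cdot v)\big(T[\,y(q_j)\oplus M\Delta_j\,]\big)\,dt\Big],$$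 where $(v'\cdot v)(\alpha)$ is the product of the interval matrix $v'(\alpha)$ and the interval vector $v(\alpha)$, $b\oplus r=\prod_i[\underline b_i-r,\overline b_i+r]$, and $T[b]=b\cap[-K,K]^n$ (these intersections are non-empty when $|Q|\le 1$). **Theorem.** Let $(u,u')\in\mathcal V^1_f$ be interval extensions of $f$ and $\overline L(f)$, i.e. $u(\{x\})=\{f(x)\}$ and $u'(\{x\})=\overline L(f)(x)$ for all $x\in[-K,K]^n$, such that $w(u(\alpha))\le\|u'(\alpha)\|_\infty\,w(\alpha)$ for all $\alpha\in\mathbb I[-K,K]^n$, and let $u'$ be interval Lipschitz. Let $(Q_m)_{m\in\mathbb N}$ be partitions of $[0,a]$ with $|Q_m|\le1$ and $|Q_m|\to0$. Let $(u_m,u'_m)\in\mathcal V^1_f$ satisfy $(u,u')=\bigsqcup_m(u_m,u'_m)$ and, for some constant $C_1>0$ and all $m$, $d(u_m,u)\le C_1|Q_m|^2$ and $d(u'_m,u')\le C_1|Q_m|^2$. Put $y_m=E^2_{(u_m,u'_m)}(Q_m)$. Then: 1. there is $C_2\ge0$ such that $w(y_m)\le C_2|Q_m|^2$ for all $m\in\mathbb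 N$; 2. the least upper bound $\bigsqcup_m y_m$ exists, is real-valued (its value at each $x\in[0,a]$ is a single point $\{y(x)\}$ of $[-K,K]^n$), and $y$ is a solution of (IVP) on $[0,a]$ (with one-sided derivatives at the end-points). -/

import Mathlib

noncomputable section

namespace IntervalEuler

/-- A non-empty compact hyper-rectangle `∏ [lo i, hi i]` of `ℝ^ι`
(an interval vector; an interval matrix when `ι` is a product). -/
@[ext]
structure Box (ι : Type) where
  lo : ι → ℝ
  hi : ι → ℝ
  lo_le_hi : ∀ i, lo i ≤ hi i

namespace Box

variable {ι : Type}

/-- The underlying set of points. -/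
def toSet (b : Box ι) : Set (ι → ℝ) := Set.Icc b.lo b.hi

/-- The information order: `b ⊑ c` iff `c ⊆ b` (reverse inclusion). -/
instance : PartialOrder (Box ι) where
  le b c := b.lo ≤ c.lo ∧ c.hi ≤ b.hi
  le_refl b := ⟨le_rfl, le_rfl⟩
  le_trans _ _ _ h h' := ⟨h.1.trans h'.1, h'.2.trans h.2⟩
  le_antisymm _ _ h h' := Box.ext (le_antisymm h.1 h'.1) (le_antisymm h'.2 h.2)

theorem le_iff_toSet_subset (b c : Box ι) : b ≤ c ↔ c.toSet ⊆ b.toSet :=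
  (Set.Icc_subset_Icc_iff (a₁ := c.lo) (b₁ := c.hi) c.lo_le_hi).symm

/-- The degenerate box `{x}`. -/
def point (x : ι → ℝ) : Box ι := ⟨x, x, fun _ => le_rfl⟩

/-- The box with opposite corners `l` and `h`; it is `∏ [l i, h i]` when `l ≤ h`. -/
def corners (l h : ι → ℝ) : Box ι :=
  ⟨fun i => min (l i) (h i), fun i => max (l i) (h i), fun _ => min_le_max⟩

/-- Interval addition. -/
def add (b c : Box ι) : Box ι :=
  ⟨fun i => b.lo i + c.lo i, fun i => b.hi i + c.hi i,
    fun i => add_le_add (b.lo_le_hi i) (c.lo_le_hi i)⟩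

/-- Product of a real number and an interval vector. -/
def smul (r : ℝ) (b : Box ι) : Box ι :=
  corners (fun i => r * b.lo i) (fun i => r * b.hi i)

/-- Symmetric expansion of a box by `r`; for `r ≥ 0` it is `∏ [lo i - r, hi i + r]`. -/
def expand (b : Box ι) (r : ℝ) : Box ι :=
  ⟨fun i => b.lo i - |r|, fun i => b.hi i + |r|,
    fun i => by linarith [b.lo_le_hi i, abs_nonneg r]⟩

/-- Interval integral `∫_s^x F(t) dt`, with bounds the integrals of the bounds of `F`
(used for `s ≤ x`). -/
def integral (F : ℝ → Box ι) (s x : ℝ) : Box ι :=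
  corners (fun i => ∫ t in s..x, (F t).lo i) (fun i => ∫ t in s..x, (F t).hi i)

/-- Lower end-point of the interval product `[a, b] * [c, d]`. -/
def mulLo (a b c d : ℝ) : ℝ := min (min (a * c) (a * d)) (min (b * c) (b * d))

/-- Upper end-point of the interval product `[a, b] * [c, d]`. -/
def mulHi (a b c d : ℝ) : ℝ := max (max (a * c) (a * d)) (max (b * c) (b * d))

theorem mulLo_le_mulHi (a b c d : ℝ) : mulLo a b c d ≤ mulHi a b c d :=
  ((min_le_left _ _).trans (min_le_left _ _)).trans
    ((le_max_left _ _).trans (le_max_left _ _))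

/-- Product of an interval matrix and an interval vector in interval arithmetic. -/
def mulVec [Fintype ι] (A : Box (ι × ι)) (v : Box ι) : Box ι :=
  ⟨fun i => ∑ j, mulLo (A.lo (i, j)) (A.hi (i, j)) (v.lo j) (v.hi j),
   fun i => ∑ j, mulHi (A.lo (i, j)) (A.hi (i, j)) (v.lo j) (v.hi j),
   fun _ => Finset.sum_le_sum fun _ _ => mulLo_le_mulHi _ _ _ _⟩

/-- Width: the largest width of an entry. -/
def width (b : Box ι) : ℝ := ⨆ i, (b.hi i - b.lo i)

/-- The distance `max_i max (|lo i - lo' i|, |hi i - hi' i|)` of two boxes. -/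
def dist (b c : Box ι) : ℝ := ⨆ i, max |b.lo i - c.lo i| |b.hi i - c.hi i|

/-- The norm `‖A‖_∞ = max_i ∑_j ‖A i j‖` of an interval matrix, where
`‖[l, h]‖ = max (|l|, |h|)`. -/
def normInf [Fintype ι] (A : Box (ι × ι)) : ℝ :=
  ⨆ i, ∑ j, max |A.lo (i, j)| |A.hi (i, j)|

end Box

/-- The interval domain of `[-R, R]^ι`: the boxes contained in `[-R, R]^ι`, under reverse
inclusion. -/
abbrev IDom (ι : Type) (R : ℝ) : Type :=
  {b : Box ι // ∀ i, -R ≤ b.lo i ∧ b.hi i ≤ R}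

/-- The cube `[-R, R]^ι`. -/
def cube (ι : Type) (R : ℝ) : Set (ι → ℝ) := {x | ∀ i, -R ≤ x i ∧ x i ≤ R}

/-- The maximal element `{x}` of the interval domain. -/
def IDom.point {ι : Type} {R : ℝ} (x : ι → ℝ) (hx : x ∈ cube ι R) : IDom ι R :=
  ⟨Box.point x, hx⟩

/-- Truncation `b ∩ [-R, R]^ι` of a box; see `toSet_trunc`.  (When the intersection is empty,
which never happens in the second-order Euler scheme, `b` is projected to the cube.) -/
def trunc {ι : Type} {R : ℝ} (hR : 0 ≤ R) (b : Box ι) : IDom ι R :=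
  ⟨⟨fun i => max (-R) (min R (b.lo i)), fun i => max (-R) (min R (b.hi i)),
      fun i => max_le_max le_rfl (min_le_min le_rfl (b.lo_le_hi i))⟩,
    fun _ => ⟨le_max_left _ _, max_le (by linarith) (min_le_left _ _)⟩⟩

theorem toSet_trunc {ι : Type} {R : ℝ} (hR : 0 ≤ R) (b : Box ι)
    (hb : (b.toSet ∩ cube ι R).Nonempty) :
    (trunc hR b).1.toSet = b.toSet ∩ cube ι R := by
  obtain ⟨z, ⟨hz1, hz2⟩, hz3⟩ := hb
  ext x
  constructor
  · rintro ⟨h1, h2⟩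
    refine ⟨⟨fun i => ?_, fun i => ?_⟩, fun i => ?_⟩
    · have h := h1 i
      have h3 := hz1 i
      have h4 := (hz3 i).2
      simp only [trunc, max_le_iff, min_eq_right (h3.trans h4)] at h
      exact h.2
    · have h := h2 i
      have h3 := hz2 i
      have h4 := (hz3 i).1
      have h5 : max (-R) (min R (b.hi i)) ≤ b.hi i :=
        max_le (h4.trans h3) (min_le_right _ _)
      exact h.trans h5
    · have h := h1 i
      have h' := h2 i
      simp only [trunc] at h h'
      exact ⟨(le_max_left _ _).trans h, h'.trans (max_le (by linarith) (min_le_left _ _))⟩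
  · rintro ⟨⟨h1, h2⟩, h3⟩
    refine ⟨fun i => max_le (h3 i).1 ((min_le_right _ _).trans (h1 i)), fun i => ?_⟩
    exact (le_min (h3 i).2 (h2 i)).trans (le_max_right _ _)

/-- The width of a box-valued function: the supremum of the widths of its values. -/
def funWidth {X ι : Type} {R : ℝ} (y : X → IDom ι R) : ENNReal :=
  ⨆ x, ENNReal.ofReal (y x).1.width

/-- The distance of two box-valued functions: the supremum of the distances of their values. -/
def funDist {X ι : Type} {R : ℝ} (g h : X → IDom ι R) : ENNReal :=
  ⨆ x, ENNReal.ofReal ((g x).1.dist (h x).1)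

/-- Interval Lipschitz functions. -/
def IntervalLipschitz {ι κ : Type} {R S : ℝ} (u : IDom ι R → IDom κ S) : Prop :=
  ∃ L : ℝ, 0 ≤ L ∧ ∀ α, (u α).1.width ≤ L * α.1.width

section Derivative

variable {n : ℕ}

/-- The single-step tie: `g x - g y ∈ b (x - y)` for all `x, y ∈ O`, where `b (x - y)` is the set
of inner products of the elements of `b` with `x - y`. -/
def Tie (O : Set (Fin n → ℝ)) (b : Box (Fin n)) (g : (Fin n → ℝ) → ℝ) : Prop :=
  ∀ x ∈ O, ∀ y ∈ O, ∃ c ∈ b.toSet, g x - g y = ∑ j, c j * (x j - y j)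

/-- The hyper-rectangular Lipschitz derivative at `x` of a scalar function `g` on `X`: the
supremum under reverse inclusion, i.e. the intersection, of all boxes `b` such that `g` lies in the
tie of `b` on a relatively open subset of `X` that contains `x` (all of `ℝ^n` if there is none). -/
def lbarScalar (X : Set (Fin n → ℝ)) (g : (Fin n → ℝ) → ℝ) (x : Fin n → ℝ) :
    Set (Fin n → ℝ) :=
  {c | ∀ (b : Box (Fin n)) (O : Set (Fin n → ℝ)), IsOpen O → x ∈ O → Tie (X ∩ O) b g →
    c ∈ b.toSet}

/-- The hyper-rectangular Lipschitz derivative at `x` of `f : X → ℝ^n`, as the set of the matrices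
whose `i`-th row lies in the derivative of the `i`-th component. -/
def lbar (X : Set (Fin n → ℝ)) (f : (Fin n → ℝ) → (Fin n → ℝ)) (x : Fin n → ℝ) :
    Set (Fin n × Fin n → ℝ) :=
  {A | ∀ i, (fun j => A (i, j)) ∈ lbarScalar X (fun z => f z i) x}

variable {K M M₁ : ℝ}

/-- The pairs `(u, u')` of Scott-continuous maps, from `𝕀[-K,K]^n` to `𝕀[-M,M]^n` and to
`𝕀[-M₁,M₁]^(n×n)`, that approximate `f` and its derivative.  The canonical extension of `f` maps
`α` to the greatest lower bound of the `{f x}`, `x ∈ α`, so lying below it means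
`f x ∈ u α` for all `x ∈ α`; likewise for `u'`.  Such pairs are consistent, with `f` as witness. -/
def V1f (f : (Fin n → ℝ) → (Fin n → ℝ)) :
    Set ((IDom (Fin n) K → IDom (Fin n) M) × (IDom (Fin n) K → IDom (Fin n × Fin n) M₁)) :=
  {p | ScottContinuous p.1 ∧ ScottContinuous p.2 ∧
    (∀ α, ∀ x ∈ α.1.toSet, f x ∈ (p.1 α).1.toSet) ∧
    (∀ α, ∀ x ∈ α.1.toSet, lbar (cube (Fin n) K) f x ⊆ (p.2 α).1.toSet)}

/-- `u` and `u'` are interval extensions of `f` and of its derivative on `[-K,K]^n`. -/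
def IsExtension (f : (Fin n → ℝ) → (Fin n → ℝ)) (u : IDom (Fin n) K → IDom (Fin n) M)
    (u' : IDom (Fin n) K → IDom (Fin n × Fin n) M₁) : Prop :=
  ∀ x (hx : x ∈ cube (Fin n) K),
    (u (IDom.point x hx)).1.toSet = {f x} ∧
    (u' (IDom.point x hx)).1.toSet = lbar (cube (Fin n) K) f x

end Derivative

/-- A partition `0 = q 0 < ⋯ < q k = a` of `[0, a]`, with `k ≥ 1`. -/
structure Partition (a : ℝ) where
  k : ℕ
  k_pos : 0 < k
  q : Fin (k + 1) → ℝ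
  strictMono : StrictMono q
  first : q 0 = 0
  last : q (Fin.last k) = a

/-- The length `Δ_j` of the `j`-th sub-interval. -/
def Partition.step {a : ℝ} (Q : Partition a) (j : Fin Q.k) : ℝ := Q.q j.succ - Q.q j.castSucc

/-- The norm `|Q|` of a partition. -/
def Partition.mesh {a : ℝ} (Q : Partition a) : ℝ := ⨆ j, Q.step j

section Euler

variable {n : ℕ} {K M M₁ a : ℝ}

theorem zero_mem_cube {ι : Type} {R : ℝ} (hR : 0 ≤ R) : (0 : ι → ℝ) ∈ cube ι R :=
  fun _ => ⟨neg_nonpos.mpr hR, hR⟩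

/-- The enclosure at `x ∈ (q_j, q_{j+1}]` computed from the enclosure `α` at `q_j`:
`T (α + ∫_{q_j}^x u(α) + (t - q_j) (u' · u)(T (α ⊕ M Δ_j)) dt)`,
where `T` is the truncation to `[-K,K]^n` and `⊕` is symmetric expansion. -/
def eulerStep (hK : 0 ≤ K) (u : IDom (Fin n) K → IDom (Fin n) M)
    (u' : IDom (Fin n) K → IDom (Fin n × Fin n) M₁) (Q : Partition a) (j : Fin Q.k)
    (α : IDom (Fin n) K) (x : ℝ) : IDom (Fin n) K :=
  let A : IDom (Fin n) K := trunc hK (α.1.expand (M * Q.step j))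
  trunc hK (α.1.add (Box.integral
    (fun t => (u α).1.add (Box.smul (t - Q.q j.castSucc) ((u' A).1.mulVec (u A).1)))
    (Q.q j.castSucc) x))

/-- The enclosures at the partition points. -/
def eulerNode (hK : 0 ≤ K) (u : IDom (Fin n) K → IDom (Fin n) M)
    (u' : IDom (Fin n) K → IDom (Fin n × Fin n) M₁) (Q : Partition a) :
    Fin (Q.k + 1) → IDom (Fin n) K :=
  Fin.induction (motive := fun _ => IDom (Fin n) K) (IDom.point 0 (zero_mem_cube hK))
    (fun j α => eulerStep hK u u' Q j α (Q.q j.succ))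

open Classical in
/-- The second-order Euler operator `E²_{(u,u')}(Q) : [0,a] → 𝕀[-K,K]^n`: its value is `{0}` at
`x = 0`, and is given by `eulerStep` from the value at `q_j` for the unique `j` with
`q_j < x ≤ q_{j+1}` when `x > 0`. -/
def euler (hK : 0 ≤ K) (u : IDom (Fin n) K → IDom (Fin n) M)
    (u' : IDom (Fin n) K → IDom (Fin n × Fin n) M₁) (Q : Partition a) :
    Set.Icc (0 : ℝ) a → IDom (Fin n) K :=
  fun x =>
    if h : ∃ j : Fin Q.k, Q.q j.castSucc < x ∧ (x : ℝ) ≤ Q.q j.succ then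
      eulerStep hK u u' Q h.choose (eulerNode hK u u' Q h.choose.castSucc) x
    else IDom.point 0 (zero_mem_cube hK)

end Euler

end IntervalEuler

end

open IntervalEuler

/-! A point has width zero, so the interval Lipschitz bound forces `u'` to be a single matrix at
every point. Hence the derivative of `f` is a singleton `{D x}`, and `f` is differentiable within
the cube (`hasFDerivWithinAt_of_lbarScalar_eq`).

Soundness: let `y` be the Picard–Lindelöf solution. By the chain rule `f ∘ y` has derivative `D (y
t) · f (y t)`, which lies in the interval product evaluated on the expanded box. Integrating twice
shows that each Euler step encloses `y` (`mem_eulerStep`, `mem_euler`).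

Accuracy: since `‖u'‖ ≤ n M₁`, both `u` and `u'` have width linear in the width of the argument, and
`v k`, `v' k` inherit this up to a term of order `|Q|²`. The product box has width `O(w + |Q|)` but
enters with the factor `h² / 2`, so a step of length `h` sends `w` to at most `w + h (c w +
O(|Q|²))` (`width_eulerStep_le`). A discrete Grönwall argument gives a global bound `O(|Q|²)`
(`width_euler_le`).

All enclosures contain `y` and their widths tend to zero, so their least upper bound is `{y}`. No
monotonicity of the sequence is needed. -/

namespace IntervalEuler

open Set Filter Topology

/-! ### Interval arithmetic: widths, products and integrals -/

namespace Box

variable {ι : Type}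

theorem width_le_iff [Finite ι] [Nonempty ι] {b : Box ι} {w : ℝ} :
    b.width ≤ w ↔ ∀ i, b.hi i - b.lo i ≤ w :=
  ciSup_le_iff (Set.finite_range _).bddAbove

theorem sub_le_width [Finite ι] (b : Box ι) (i : ι) : b.hi i - b.lo i ≤ b.width :=
  le_ciSup (f := fun i => b.hi i - b.lo i) (Set.finite_range _).bddAbove i

theorem width_nonneg (b : Box ι) : 0 ≤ b.width :=
  Real.iSup_nonneg fun i => sub_nonneg.2 (b.lo_le_hi i)

theorem width_point (x : ι → ℝ) : (point x).width = 0 := by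
  simp [width, point]

theorem abs_lo_sub_le_dist [Finite ι] (b c : Box ι) (i : ι) : |b.lo i - c.lo i| ≤ b.dist c :=
  (le_max_left _ _).trans
    (le_ciSup (f := fun i => max |b.lo i - c.lo i| |b.hi i - c.hi i|)
      (Set.finite_range _).bddAbove i)

theorem abs_hi_sub_le_dist [Finite ι] (b c : Box ι) (i : ι) : |b.hi i - c.hi i| ≤ b.dist c :=
  (le_max_right _ _).trans
    (le_ciSup (f := fun i => max |b.lo i - c.lo i| |b.hi i - c.hi i|)
      (Set.finite_range _).bddAbove i)

/-- The width is `2`-Lipschitz with respect to the distance of boxes. -/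
theorem width_le_add_dist [Finite ι] [Nonempty ι] (b c : Box ι) :
    b.width ≤ c.width + 2 * b.dist c := by
  refine width_le_iff.2 fun i => ?_
  have h1 := abs_le.1 (abs_lo_sub_le_dist b c i)
  have h2 := abs_le.1 (abs_hi_sub_le_dist b c i)
  linarith [sub_le_width c i, h1.1, h2.2]

/-- A product is affine in each factor separately, so it is largest at a corner of the rectangle. -/
theorem mul_le_mulHi {a b c d p q : ℝ} (hap : a ≤ p) (hpb : p ≤ b) (hcq : c ≤ q) (hqd : q ≤ d) :
    p * q ≤ mulHi a b c d := by
  have key (r : ℝ) : r * q ≤ max (r * c) (r * d) := by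
    rcases le_total 0 r with h | h
    · exact le_max_of_le_right (mul_le_mul_of_nonneg_left hqd h)
    · exact le_max_of_le_left (mul_le_mul_of_nonpos_left hcq h)
  rcases le_total 0 q with h | h
  · exact (mul_le_mul_of_nonneg_right hpb h).trans ((key b).trans (le_max_right _ _))
  · exact (mul_le_mul_of_nonpos_right hap h).trans ((key a).trans (le_max_left _ _))

theorem mulLo_le_mul {a b c d p q : ℝ} (hap : a ≤ p) (hpb : p ≤ b) (hcq : c ≤ q) (hqd : q ≤ d) :
    mulLo a b c d ≤ p * q := by
  have key (r : ℝ) : min (r * c) (r * d) ≤ r * q := by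
    rcases le_total 0 r with h | h
    · exact min_le_of_left_le (mul_le_mul_of_nonneg_left hcq h)
    · exact min_le_of_right_le (mul_le_mul_of_nonpos_left hqd h)
  rcases le_total 0 q with h | h
  · exact (min_le_left _ _).trans ((key a).trans (mul_le_mul_of_nonneg_right hap h))
  · exact (min_le_right _ _).trans ((key b).trans (mul_le_mul_of_nonpos_right hpb h))

theorem exists_mulHi_eq {a b : ℝ} (hab : a ≤ b) {c d : ℝ} (hcd : c ≤ d) :
    ∃ p ∈ Icc a b, ∃ q ∈ Icc c d, mulHi a b c d = p * q := by
  rcases max_choice (max (a * c) (a * d)) (max (b * c) (b * d)) with h | h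
  · rcases max_choice (a * c) (a * d) with h' | h'
    · exact ⟨a, ⟨le_rfl, hab⟩, c, ⟨le_rfl, hcd⟩, h.trans h'⟩
    · exact ⟨a, ⟨le_rfl, hab⟩, d, ⟨hcd, le_rfl⟩, h.trans h'⟩
  · rcases max_choice (b * c) (b * d) with h' | h'
    · exact ⟨b, ⟨hab, le_rfl⟩, c, ⟨le_rfl, hcd⟩, h.trans h'⟩
    · exact ⟨b, ⟨hab, le_rfl⟩, d, ⟨hcd, le_rfl⟩, h.trans h'⟩

theorem exists_mulLo_eq {a b : ℝ} (hab : a ≤ b) {c d : ℝ} (hcd : c ≤ d) :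
    ∃ p ∈ Icc a b, ∃ q ∈ Icc c d, mulLo a b c d = p * q := by
  rcases min_choice (min (a * c) (a * d)) (min (b * c) (b * d)) with h | h
  · rcases min_choice (a * c) (a * d) with h' | h'
    · exact ⟨a, ⟨le_rfl, hab⟩, c, ⟨le_rfl, hcd⟩, h.trans h'⟩
    · exact ⟨a, ⟨le_rfl, hab⟩, d, ⟨hcd, le_rfl⟩, h.trans h'⟩
  · rcases min_choice (b * c) (b * d) with h' | h'
    · exact ⟨b, ⟨hab, le_rfl⟩, c, ⟨le_rfl, hcd⟩, h.trans h'⟩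
    · exact ⟨b, ⟨hab, le_rfl⟩, d, ⟨hcd, le_rfl⟩, h.trans h'⟩

/-- The width of a product of intervals contained in `[-r, r]` and `[-s, s]`. -/
theorem mulHi_sub_mulLo_le {a b c d r s : ℝ} (hab : a ≤ b) (hcd : c ≤ d) (har : -r ≤ a)
    (hbr : b ≤ r) (hcs : -s ≤ c) (hds : d ≤ s) :
    mulHi a b c d - mulLo a b c d ≤ r * (d - c) + s * (b - a) := by
  obtain ⟨p, ⟨hp1, hp2⟩, q, ⟨hq1, hq2⟩, h⟩ := exists_mulHi_eq hab hcd
  obtain ⟨p', ⟨hp1', hp2'⟩, q', ⟨hq1', hq2'⟩, h'⟩ := exists_mulLo_eq hab hcd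
  have hp : |p| ≤ r := abs_le.2 ⟨by linarith, by linarith⟩
  have hq : |q'| ≤ s := abs_le.2 ⟨by linarith, by linarith⟩
  have hpp : |p - p'| ≤ b - a := abs_le.2 ⟨by linarith, by linarith⟩
  have hqq : |q - q'| ≤ d - c := abs_le.2 ⟨by linarith, by linarith⟩
  -- Both extremes are genuine products, so their difference telescopes through `p * q'`.
  calc mulHi a b c d - mulLo a b c d = p * (q - q') + q' * (p - p') := by rw [h, h']; ring
    _ ≤ |p| * |q - q'| + |q'| * |p - p'| :=
      add_le_add ((le_abs_self _).trans_eq (abs_mul _ _)) ((le_abs_self _).trans_eq (abs_mul _ _))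
    _ ≤ r * (d - c) + s * (b - a) :=
      add_le_add (mul_le_mul hp hqq (abs_nonneg _) ((abs_nonneg _).trans hp))
        (mul_le_mul hq hpp (abs_nonneg _) ((abs_nonneg _).trans hq))

theorem sum_mul_mem_mulVec [Fintype ι] {A : Box (ι × ι)} {v : Box ι} {B : ι × ι → ℝ} {x : ι → ℝ}
    (hB : B ∈ A.toSet) (hx : x ∈ v.toSet) :
    (fun i => ∑ j, B (i, j) * x j) ∈ (A.mulVec v).toSet :=
  ⟨fun i => Finset.sum_le_sum fun j _ =>
      mulLo_le_mul (hB.1 (i, j)) (hB.2 (i, j)) (hx.1 j) (hx.2 j),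
    fun i => Finset.sum_le_sum fun j _ =>
      mul_le_mulHi (hB.1 (i, j)) (hB.2 (i, j)) (hx.1 j) (hx.2 j)⟩

theorem width_mulVec_le [Fintype ι] [Nonempty ι] {R S : ℝ} (hR : 0 ≤ R) (hS : 0 ≤ S)
    (A : IDom (ι × ι) R) (v : IDom ι S) :
    (A.1.mulVec v.1).width ≤ Fintype.card ι * (R * v.1.width + S * A.1.width) := by
  refine width_le_iff.2 fun i => ?_
  rw [mulVec, ← Finset.sum_sub_distrib, ← nsmul_eq_mul]
  refine Finset.sum_le_card_nsmul _ _ _ fun j _ => ?_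
  refine (mulHi_sub_mulLo_le (A.1.lo_le_hi _) (v.1.lo_le_hi _) (A.2 _).1 (A.2 _).2
    (v.2 _).1 (v.2 _).2).trans ?_
  gcongr
  · exact sub_le_width v.1 j
  · exact sub_le_width A.1 (i, j)

/-- Turns the width hypothesis on `u` into a Lipschitz bound with the uniform constant `n M₁`. -/
theorem normInf_le [Fintype ι] [Nonempty ι] {R : ℝ} (A : IDom (ι × ι) R) :
    A.1.normInf ≤ Fintype.card ι * R := by
  refine ciSup_le fun i => ?_
  rw [← nsmul_eq_mul]
  refine Finset.sum_le_card_nsmul _ _ _ fun j _ => max_le ?_ ?_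
  · exact abs_le.2 ⟨(A.2 _).1, (A.1.lo_le_hi _).trans (A.2 _).2⟩
  · exact abs_le.2 ⟨(A.2 _).1.trans (A.1.lo_le_hi _), (A.2 _).2⟩

theorem integral_affine (s x c p : ℝ) :
    ∫ t in s..x, (c + (t - s) * p) = (x - s) * c + (x - s) ^ 2 / 2 * p := by
  rw [intervalIntegral.integral_eq_sub_of_hasDerivAt
    (f := fun t => (t - s) * c + (t - s) ^ 2 / 2 * p)]
  · ring
  · intro t _
    have h := (hasDerivAt_id t).sub_const s
    refine ((h.mul_const c).add (((h.pow 2).div_const 2).mul_const p)).congr_deriv ?_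
    simp
  · exact (by fun_prop : Continuous fun t => c + (t - s) * p).intervalIntegrable _ _

/-- For `t ≥ s` the factor `t - s` is nonnegative, so no end-points are swapped and each bound is
the integral of an affine function. -/
theorem integral_add_smul (b p : Box ι) {s x : ℝ} (h : s ≤ x) :
    integral (fun t => b.add (smul (t - s) p)) s x =
      ⟨fun i => (x - s) * b.lo i + (x - s) ^ 2 / 2 * p.lo i,
       fun i => (x - s) * b.hi i + (x - s) ^ 2 / 2 * p.hi i,
       fun i => add_le_add (mul_le_mul_of_nonneg_left (b.lo_le_hi i) (sub_nonneg.2 h))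
        (mul_le_mul_of_nonneg_left (p.lo_le_hi i) (by positivity))⟩ := by
  have hlo (i : ι) : ∫ t in s..x, (b.add (smul (t - s) p)).lo i =
      (x - s) * b.lo i + (x - s) ^ 2 / 2 * p.lo i := by
    rw [← integral_affine]
    refine intervalIntegral.integral_congr fun t ht => ?_
    rw [uIcc_of_le h] at ht
    simp only [add, smul, corners]
    rw [min_eq_left (mul_le_mul_of_nonneg_left (p.lo_le_hi i) (sub_nonneg.2 ht.1))]
  have hhi (i : ι) : ∫ t in s..x, (b.add (smul (t - s) p)).hi i =
      (x - s) * b.hi i + (x - s) ^ 2 / 2 * p.hi i := by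
    rw [← integral_affine]
    refine intervalIntegral.integral_congr fun t ht => ?_
    rw [uIcc_of_le h] at ht
    simp only [add, smul, corners]
    rw [max_eq_right (mul_le_mul_of_nonneg_left (p.lo_le_hi i) (sub_nonneg.2 ht.1))]
  have hle (i : ι) : (x - s) * b.lo i + (x - s) ^ 2 / 2 * p.lo i ≤
      (x - s) * b.hi i + (x - s) ^ 2 / 2 * p.hi i :=
    add_le_add (mul_le_mul_of_nonneg_left (b.lo_le_hi i) (sub_nonneg.2 h))
      (mul_le_mul_of_nonneg_left (p.lo_le_hi i) (by positivity))
  ext i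
  · simp only [integral, corners, hlo, hhi, min_eq_left (hle i)]
  · simp only [integral, corners, hlo, hhi, max_eq_right (hle i)]

end Box

/-! ### Truncation to the cube and partitions -/

/-- Clamping to `[-R, R]` is monotone and 1-Lipschitz. -/
theorem width_trunc_le {ι : Type} [Finite ι] [Nonempty ι] {R : ℝ} (hR : 0 ≤ R) (b : Box ι) :
    (trunc hR b).1.width ≤ b.width := by
  refine Box.width_le_iff.2 fun i => (?_ : _ ≤ b.hi i - b.lo i).trans (b.sub_le_width i)
  have h := b.lo_le_hi i
  simp only [trunc]
  rcases le_total R (b.lo i) with h1 | h1 <;> rcases le_total R (b.hi i) with h2 | h2 <;>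
    rcases le_total (-R) (b.lo i) with h3 | h3 <;> rcases le_total (-R) (b.hi i) with h4 | h4 <;>
    simp [*] <;> linarith

theorem mem_trunc {ι : Type} {R : ℝ} (hR : 0 ≤ R) {b : Box ι} {x : ι → ℝ} (hx : x ∈ b.toSet)
    (hx' : x ∈ cube ι R) : x ∈ (trunc hR b).1.toSet := by
  rw [toSet_trunc hR b ⟨x, hx, hx'⟩]
  exact ⟨hx, hx'⟩

theorem cube_eq_closedBall {ι : Type} [Fintype ι] {R : ℝ} (hR : 0 ≤ R) :
    cube ι R = Metric.closedBall 0 R := by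
  ext x
  simp [cube, pi_norm_le_iff_of_nonneg hR, abs_le]

theorem dist_le_of_funDist_le {X ι : Type} {R : ℝ} {g h : X → IDom ι R} {c : ℝ} (hc : 0 ≤ c)
    (H : funDist g h ≤ ENNReal.ofReal c) (x : X) : (g x).1.dist (h x).1 ≤ c :=
  (ENNReal.ofReal_le_ofReal_iff hc).1 ((le_iSup _ x).trans H)

theorem Partition.step_pos {a : ℝ} (Q : Partition a) (j : Fin Q.k) : 0 < Q.step j :=
  sub_pos.2 (Q.strictMono Fin.castSucc_lt_succ)

theorem Partition.step_le_mesh {a : ℝ} (Q : Partition a) (j : Fin Q.k) : Q.step j ≤ Q.mesh :=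
  le_ciSup (f := Q.step) (Set.finite_range _).bddAbove j

theorem Partition.q_nonneg {a : ℝ} (Q : Partition a) (j : Fin (Q.k + 1)) : 0 ≤ Q.q j :=
  Q.first ▸ Q.strictMono.monotone (Fin.zero_le j)

theorem Partition.q_le {a : ℝ} (Q : Partition a) (j : Fin (Q.k + 1)) : Q.q j ≤ a :=
  (Q.strictMono.monotone (Fin.le_last j)).trans_eq Q.last

theorem Partition.exists_mem_Ioc {a : ℝ} (Q : Partition a) {x : ℝ} (h0 : 0 < x) (ha : x ≤ a) :
    ∃ j : Fin Q.k, Q.q j.castSucc < x ∧ x ≤ Q.q j.succ := by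
  have key : ∀ i : Fin (Q.k + 1), x ≤ Q.q i →
      ∃ j : Fin Q.k, Q.q j.castSucc < x ∧ x ≤ Q.q j.succ := by
    refine Fin.induction (fun h => absurd (h.trans_eq Q.first) h0.not_ge) fun j ih h => ?_
    rcases lt_or_ge (Q.q j.castSucc) x with h' | h'
    · exact ⟨j, h', h⟩
    · exact ih h'
  exact key (Fin.last _) (ha.trans_eq Q.last.symm)

/-! ### Differentiability from a point-valued Lipschitz derivative -/

section Derivative

variable {n : ℕ}

/-- If the derivative of `g` at `x` is confined to a single point `D`, then the difference
quotients of `g` near `x` in the coordinate directions are close to the entries of `D`. -/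
theorem eventually_abs_sub_le_of_lbarScalar_subset {X : Set (Fin n → ℝ)} {g : (Fin n → ℝ) → ℝ}
    {x D : Fin n → ℝ} (hD : D ∈ lbarScalar X g x) (hD' : lbarScalar X g x ⊆ {D})
    {ε : ℝ} (hε : 0 < ε) :
    ∀ᶠ O in (𝓝 x).smallSets, ∀ y ∈ X ∩ O, ∀ z ∈ X ∩ O, ∀ j, (∀ k ≠ j, y k = z k) →
      |g y - g z - D j * (y j - z j)| ≤ ε * |y j - z j| := by
  -- If `y` and `z` differ only in coordinate `j`, the inner product has one term, and the tie
  -- confines the slope to the `j`-th edge of `b`.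
  have tie {b : Box (Fin n)} {O : Set (Fin n → ℝ)} (hb : Tie O b g) {y z : Fin n → ℝ}
      (hy : y ∈ O) (hz : z ∈ O) {j : Fin n} (hj : ∀ k ≠ j, y k = z k) :
      ∃ c ∈ Icc (b.lo j) (b.hi j), g y - g z = c * (y j - z j) := by
    obtain ⟨c, hc, h⟩ := hb y hy z hz
    refine ⟨c j, ⟨hc.1 j, hc.2 j⟩, h.trans ?_⟩
    refine Finset.sum_eq_single j (fun k _ hk => ?_) (by simp)
    rw [hj k hk, sub_self, mul_zero]
  -- moving one entry of `D` leaves the derivative, so some tie bounds this entry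
  have move (j : Fin n) (r : ℝ) (hr : r ≠ D j) : ∃ (b : Box (Fin n)) (O : Set (Fin n → ℝ)),
      IsOpen O ∧ x ∈ O ∧ Tie (X ∩ O) b g ∧ D j ∈ Icc (b.lo j) (b.hi j) ∧
        r ∉ Icc (b.lo j) (b.hi j) := by
    have hn : Function.update D j r ∉ lbarScalar X g x := fun h => hr <| by
      simpa using congrFun (hD' h) j
    simp only [lbarScalar, mem_ofPred_eq, not_forall] at hn
    obtain ⟨b, O, hO, hxO, hb, hn⟩ := hn
    have hDb := hD b O hO hxO hb
    refine ⟨b, O, hO, hxO, hb, ⟨hDb.1 j, hDb.2 j⟩, fun h => hn ⟨fun k => ?_, fun k => ?_⟩⟩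
    all_goals rcases eq_or_ne k j with rfl | hk
    · simpa using h.1
    · simpa [hk] using hDb.1 k
    · simpa using h.2
    · simpa [hk] using hDb.2 k
  -- Excluding `D j + ε` and `D j - ε` gives two ties. Each edge contains `D j`, so the first stays
  -- below `D j + ε` and the second above `D j - ε`.
  have upper (j : Fin n) : ∀ᶠ O in (𝓝 x).smallSets, ∀ y ∈ X ∩ O, ∀ z ∈ X ∩ O,
      (∀ k ≠ j, y k = z k) → z j ≤ y j → |g y - g z - D j * (y j - z j)| ≤ ε * (y j - z j) := by
    obtain ⟨b, O, hO, hxO, hb, hm, hr⟩ := move j (D j + ε) (by linarith)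
    obtain ⟨b', O', hO', hxO', hb', hm', hr'⟩ := move j (D j - ε) (by linarith)
    rw [eventually_smallSets]
    refine ⟨O ∩ O', inter_mem (hO.mem_nhds hxO) (hO'.mem_nhds hxO'), ?_⟩
    intro V hV y hy z hz hyz hle
    obtain ⟨c, hc, h⟩ := tie hb ⟨hy.1, (hV hy.2).1⟩ ⟨hz.1, (hV hz.2).1⟩ hyz
    obtain ⟨c', hc', h'⟩ := tie hb' ⟨hy.1, (hV hy.2).2⟩ ⟨hz.1, (hV hz.2).2⟩ hyz
    have h1 : c ≤ D j + ε := by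
      by_contra! hlt
      exact hr ⟨by linarith [hm.1], by linarith [hc.2]⟩
    have h2 : D j - ε ≤ c' := by
      by_contra! hlt
      exact hr' ⟨by linarith [hc'.1], by linarith [hm'.2]⟩
    have h3 := mul_le_mul_of_nonneg_right h1 (sub_nonneg.2 hle)
    have h4 := mul_le_mul_of_nonneg_right h2 (sub_nonneg.2 hle)
    exact abs_le.2 ⟨by linarith, by linarith⟩
  filter_upwards [eventually_all.2 upper] with O hO y hy z hz j hj
  rcases le_total (z j) (y j) with h | h
  · rw [abs_of_nonneg (sub_nonneg.2 h)]
    exact hO j y hy z hz hj h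
  · rw [abs_sub_comm (y j), abs_of_nonneg (sub_nonneg.2 h), abs_sub_comm,
      show D j * (y j - z j) - (g y - g z) = g z - g y - D j * (z j - y j) by ring]
    exact hO j z hz y hy (fun k hk => (hj k hk).symm) h

/-- A function whose hyper-rectangular Lipschitz derivative at a point of a cube is a single vector
is differentiable there, with this vector as gradient. -/
theorem hasFDerivWithinAt_of_lbarScalar_eq {K : ℝ} {g : (Fin n → ℝ) → ℝ} {x D : Fin n → ℝ}
    (hx : x ∈ cube (Fin n) K) (hD : lbarScalar (cube (Fin n) K) g x = {D}) :
    HasFDerivWithinAt g (∑ j, D j • ContinuousLinearMap.proj (R := ℝ) (φ := fun _ => ℝ) j)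
      (cube (Fin n) K) x := by
  rw [hasFDerivWithinAt_iff_isLittleO, Asymptotics.isLittleO_iff]
  intro c hc
  -- There are `n` coordinate moves, each costing at most `c / (n + 1) * ‖y - x‖`; the `+ 1` covers
  -- `n = 0`.
  have hε : 0 < c / (n + 1) := by positivity
  obtain ⟨δ, hδ, hball⟩ := (eventually_abs_sub_le_of_lbarScalar_subset
    (hD.symm ▸ mem_singleton D) hD.subset hε).exists_mem_basis_of_smallSets Metric.nhds_basis_ball
  filter_upwards [self_mem_nhdsWithin, mem_nhdsWithin_of_mem_nhds (Metric.ball_mem_nhds x hδ)]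
    with y hy hyδ
  -- The path from `x` to `y` changes one coordinate at a time. It stays in the cube and in the
  -- sup-norm ball because both are products.
  have mem (s : Finset (Fin n)) : s.piecewise y x ∈ cube (Fin n) K ∩ Metric.ball x δ := by
    refine ⟨fun i => ?_, ?_⟩
    · by_cases h : i ∈ s
      · simpa [h] using hy i
      · simpa [h] using hx i
    · rw [Metric.mem_ball, dist_pi_lt_iff hδ] at hyδ ⊢
      intro i
      by_cases h : i ∈ s
      · simpa [h] using hyδ i
      · simpa [h] using hδ
  have key (s : Finset (Fin n)) : |g (s.piecewise y x) - g x - ∑ j ∈ s, D j * (y j - x j)| ≤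
      ∑ j ∈ s, c / (n + 1) * |y j - x j| := by
    induction s using Finset.induction_on with
    | empty => simp
    | insert j s hj ih =>
      have h := hball _ (mem (insert j s)) _ (mem s) j fun k hk => by
        by_cases hks : k ∈ s <;> simp [hks, hk]
      simp only [Finset.piecewise_insert_self, Finset.piecewise_eq_of_notMem _ _ _ hj] at h
      rw [Finset.sum_insert hj, Finset.sum_insert hj]
      refine le_trans ?_ (add_le_add h ih)
      refine le_trans (le_of_eq ?_) (abs_add_le _ _)
      congr 1
      ring
  have h := key Finset.univ
  rw [Finset.piecewise_univ] at h
  simp only [sum_apply, smul_apply,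
    ContinuousLinearMap.proj_apply, Pi.sub_apply, smul_eq_mul, Real.norm_eq_abs]
  refine h.trans ?_
  have h' : ∑ j, c / (n + 1) * |y j - x j| ≤
      (Finset.univ : Finset (Fin n)).card • (c / (n + 1) * ‖y - x‖) :=
    Finset.sum_le_card_nsmul _ _ _ fun j _ =>
      mul_le_mul_of_nonneg_left (norm_le_pi_norm (y - x) j) hε.le
  refine h'.trans ?_
  rw [Finset.card_univ, Fintype.card_fin, nsmul_eq_mul, ← mul_assoc]
  refine mul_le_mul_of_nonneg_right ?_ (norm_nonneg _)
  rw [mul_div_assoc', div_le_iff₀ (by positivity)]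
  linarith

/-- Row form of `hasFDerivWithinAt_of_lbarScalar_eq` along a curve. -/
theorem hasDerivWithinAt_comp_of_lbar_eq {K : ℝ} {f : (Fin n → ℝ) → Fin n → ℝ}
    {D : Fin n × Fin n → ℝ} {y : ℝ → Fin n → ℝ} {y' : Fin n → ℝ} {s : Set ℝ} {t : ℝ}
    (hD : lbar (cube (Fin n) K) f (y t) = {D}) (hs : MapsTo y s (cube (Fin n) K)) (ht : t ∈ s)
    (hy : HasDerivWithinAt y y' s t) (i : Fin n) :
    HasDerivWithinAt (fun τ => f (y τ) i) (∑ j, D (i, j) * y' j) s t := by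
  have hrow : lbarScalar (cube (Fin n) K) (fun z => f z i) (y t) = {fun j => D (i, j)} := by
    have hmem : D ∈ lbar (cube (Fin n) K) f (y t) := hD ▸ mem_singleton D
    refine subset_antisymm (fun c hc => ?_) (singleton_subset_iff.2 (hmem i))
    -- Replacing row `i` of `D` by `c` gives another element of the matrix derivative, hence `D`
    -- itself.
    have h : (fun p : Fin n × Fin n => if p.1 = i then c p.2 else D p) ∈
        lbar (cube (Fin n) K) f (y t) := by
      intro k
      rcases eq_or_ne k i with rfl | hk
      · simpa using hc
      · simpa [hk] using hmem k
    rw [hD, mem_singleton_iff] at h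
    ext j
    simpa using congrFun h (i, j)
  have h := (hasFDerivWithinAt_of_lbarScalar_eq (hs ht) hrow).comp_hasDerivWithinAt t hy hs
  simpa [Function.comp_def] using h

end Derivative

/-! ### Quadratic comparison and existence of a solution -/

/-- The parabola with derivative `A + (t - s) * B`, minus `φ`, is monotone. The case `B = 0` is the
usual mean value bound. -/
theorem le_add_affine_of_hasDerivWithinAt {φ φ' : ℝ → ℝ} {s b A B : ℝ} (hsb : s ≤ b)
    (hφ : ∀ t ∈ Icc s b, HasDerivWithinAt φ (φ' t) (Icc s b) t)
    (hφ' : ∀ t ∈ Icc s b, φ' t ≤ A + (t - s) * B) :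
    φ b ≤ φ s + ((b - s) * A + (b - s) ^ 2 / 2 * B) := by
  have hP (t : ℝ) : HasDerivAt (fun t => (t - s) * A + (t - s) ^ 2 / 2 * B)
      (A + (t - s) * B) t := by
    have h := (hasDerivAt_id t).sub_const s
    refine ((h.mul_const A).add (((h.pow 2).div_const 2).mul_const B)).congr_deriv ?_
    simp
  have hd (t : ℝ) (ht : t ∈ Icc s b) := (hP t).hasDerivWithinAt.sub (hφ t ht)
  have := monotoneOn_of_hasDerivWithinAt_nonneg (convex_Icc s b)
    (fun t ht => (hd t ht).continuousWithinAt)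
    (fun t ht => (hd t (interior_subset ht)).mono interior_subset)
    (fun t ht => sub_nonneg.2 (hφ' t (interior_subset ht)))
    (left_mem_Icc.2 hsb) (right_mem_Icc.2 hsb) hsb
  simp only [Pi.sub_apply, sub_self] at this
  linarith

theorem add_affine_le_of_hasDerivWithinAt {φ φ' : ℝ → ℝ} {s b A B : ℝ} (hsb : s ≤ b)
    (hφ : ∀ t ∈ Icc s b, HasDerivWithinAt φ (φ' t) (Icc s b) t)
    (hφ' : ∀ t ∈ Icc s b, A + (t - s) * B ≤ φ' t) :
    φ s + ((b - s) * A + (b - s) ^ 2 / 2 * B) ≤ φ b := by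
  have := le_add_affine_of_hasDerivWithinAt (A := -A) (B := -B) hsb
    (fun t ht => (hφ t ht).neg) fun t ht => by linarith [hφ' t ht]
  simp only [Pi.neg_apply] at this
  linarith

/-- Existence for the autonomous initial value problem on a cube. -/
theorem exists_solution_mem_cube {ι : Type} [Fintype ι] {K M a : ℝ} (hK : 0 ≤ K) (hM : 0 ≤ M)
    (ha : 0 ≤ a) (haK : M * a ≤ K) {f : (ι → ℝ) → ι → ℝ} (hf : MapsTo f (cube ι K) (cube ι M))
    (hfLip : ∃ L : NNReal, LipschitzOnWith L f (cube ι K)) :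
    ∃ y : ℝ → ι → ℝ, (∀ t, y t ∈ cube ι K) ∧ y 0 = 0 ∧
      ∀ t ∈ Icc 0 a, HasDerivWithinAt y (f (y t)) (Icc 0 a) t := by
  obtain ⟨L, hL⟩ := hfLip
  lift K to NNReal using hK
  lift M to NNReal using hM
  rw [cube_eq_closedBall K.coe_nonneg, cube_eq_closedBall M.coe_nonneg] at hf
  rw [cube_eq_closedBall K.coe_nonneg] at hL ⊢
  have hpl : IsPicardLindelof (fun _ => f) (⟨0, left_mem_Icc.2 ha⟩ : Icc 0 a) 0 K 0 M L :=
    { lipschitzOnWith := fun _ _ => hL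
      continuousOn := fun _ _ => continuousOn_const
      norm_le := fun _ _ x hx => by simpa using hf hx
      mul_max_le := by simpa [ha] using haK }
  have h0 : (0 : ι → ℝ) ∈ Metric.closedBall (0 : ι → ℝ) ((0 : NNReal) : ℝ) := by simp
  -- Working with the Picard fixed point itself keeps the information that the curve stays in the
  -- ball; `compProj` extends it to all real times by projection onto `[0, a]`.
  obtain ⟨α, hα⟩ := ODE.FunSpace.exists_isFixedPt_next hpl h0
  have hmem (t : ℝ) : α.compProj t ∈ Metric.closedBall (0 : ι → ℝ) K :=
    α.compProj_mem_closedBall hpl.mul_max_le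
  have hfix (t : ℝ) (ht : t ∈ Icc 0 a) : α.compProj t =
      ODE.picard (fun _ => f) 0 0 α.compProj t := by
    conv_lhs => rw [← hα]
    rw [ODE.FunSpace.compProj_apply, ODE.FunSpace.next_apply, projIcc_of_mem _ ht]
  refine ⟨α.compProj, hmem, ?_, fun t ht => ?_⟩
  · rw [hfix 0 (left_mem_Icc.2 ha), ODE.picard_apply₀]
  · refine (ODE.hasDerivWithinAt_picard_Icc (left_mem_Icc.2 ha)
      (u := Metric.closedBall 0 K) (f := fun _ => f) ?_ α.continuous_compProj.continuousOn
      (fun t _ => hmem t) 0 ht).congr hfix (hfix t ht)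
    exact hL.continuousOn.comp continuousOn_snd fun p hp => hp.2

/-! ### Soundness, width growth and limit of the Euler enclosures -/

section Euler

variable {n : ℕ} {K M M₁ a : ℝ}

/-- One step of the second-order Euler scheme encloses the solution. -/
theorem mem_eulerStep (hK : 0 ≤ K) (hM : 0 ≤ M) {f : (Fin n → ℝ) → Fin n → ℝ}
    (hf : MapsTo f (cube (Fin n) K) (cube (Fin n) M))
    {v : IDom (Fin n) K → IDom (Fin n) M} {v' : IDom (Fin n) K → IDom (Fin n × Fin n) M₁}
    (hv : (v, v') ∈ V1f f) {D : (Fin n → ℝ) → Fin n × Fin n → ℝ}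
    (hD : ∀ x ∈ cube (Fin n) K, lbar (cube (Fin n) K) f x = {D x})
    {y : ℝ → Fin n → ℝ} (hyK : ∀ t, y t ∈ cube (Fin n) K)
    (hy : ∀ t ∈ Icc 0 a, HasDerivWithinAt y (f (y t)) (Icc 0 a) t) (Q : Partition a)
    (j : Fin Q.k) {α : IDom (Fin n) K} (hα : y (Q.q j.castSucc) ∈ α.1.toSet) {x : ℝ}
    (hx : Q.q j.castSucc ≤ x) (hx' : x ≤ Q.q j.succ) :
    y x ∈ (eulerStep hK v v' Q j α x).1.toSet := by
  obtain ⟨-, -, hv1, hv2⟩ := hv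
  set s := Q.q j.castSucc
  set A : IDom (Fin n) K := trunc hK (α.1.expand (M * Q.step j))
  set P := (v' A).1.mulVec (v A).1
  have hsub (b : ℝ) (hb : b ≤ x) : Icc s b ⊆ Icc 0 a := fun t ht =>
    ⟨(Q.q_nonneg _).trans ht.1, ht.2.trans (hb.trans (hx'.trans (Q.q_le _)))⟩
  have hyi (b : ℝ) (hb : b ≤ x) (i : Fin n) (t : ℝ) (ht : t ∈ Icc s b) :
      HasDerivWithinAt (fun τ => y τ i) (f (y t) i) (Icc s b) t :=
    hasDerivWithinAt_pi.1 ((hy t (hsub b hb ht)).mono (hsub b hb)) i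
  have hstep : 0 ≤ M * Q.step j := mul_nonneg hM (Q.step_pos j).le
  -- Each coordinate has speed at most `M`, so the curve moves by at most `M Δ_j` during the step.
  have hyA (t : ℝ) (ht : t ∈ Icc s x) : y t ∈ A.1.toSet := by
    have hts : M * (t - s) ≤ M * Q.step j :=
      mul_le_mul_of_nonneg_left (sub_le_sub_right (ht.2.trans hx') s) hM
    refine mem_trunc hK ⟨fun i => ?_, fun i => ?_⟩ (hyK t)
    · have h := add_affine_le_of_hasDerivWithinAt (A := -M) (B := 0) ht.1 (hyi t ht.2 i)
        fun τ _ => by simpa using (hf (hyK τ) i).1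
      have := hα.1 i
      simp only [Box.expand, abs_of_nonneg hstep]
      linarith
    · have h := le_add_affine_of_hasDerivWithinAt (A := M) (B := 0) ht.1 (hyi t ht.2 i)
        fun τ _ => by simpa using (hf (hyK τ) i).2
      have := hα.2 i
      simp only [Box.expand, abs_of_nonneg hstep]
      linarith
  have hmem (t : ℝ) (ht : t ∈ Icc s x) :
      (fun i => ∑ k, D (y t) (i, k) * f (y t) k) ∈ P.toSet :=
    Box.sum_mul_mem_mulVec
      (hv2 A _ (hyA t ht) (by rw [hD _ (hyK t)]; exact mem_singleton _)) (hv1 A _ (hyA t ht))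
  have hfy (b : ℝ) (hb : b ≤ x) (i : Fin n) (t : ℝ) (ht : t ∈ Icc s b) :
      HasDerivWithinAt (fun τ => f (y τ) i) (∑ k, D (y t) (i, k) * f (y t) k) (Icc s b) t :=
    hasDerivWithinAt_comp_of_lbar_eq (hD _ (hyK t)) (fun τ _ => hyK τ) ht
      ((hy t (hsub b hb ht)).mono (hsub b hb)) i
  have hvα := hv1 α _ hα
  -- First integration: `f ∘ y` starts in `v α` and its derivative stays in `P`. The second
  -- integration, in `goal`, bounds `y` itself.
  have hup (i : Fin n) (t : ℝ) (ht : t ∈ Icc s x) :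
      f (y t) i ≤ (v α).1.hi i + (t - s) * P.hi i := by
    have h := le_add_affine_of_hasDerivWithinAt (A := P.hi i) (B := 0) ht.1 (hfy t ht.2 i)
      fun τ hτ => by simpa using (hmem τ ⟨hτ.1, hτ.2.trans ht.2⟩).2 i
    have := hvα.2 i
    linarith
  have hdown (i : Fin n) (t : ℝ) (ht : t ∈ Icc s x) :
      (v α).1.lo i + (t - s) * P.lo i ≤ f (y t) i := by
    have h := add_affine_le_of_hasDerivWithinAt (A := P.lo i) (B := 0) ht.1 (hfy t ht.2 i)
      fun τ hτ => by simpa using (hmem τ ⟨hτ.1, hτ.2.trans ht.2⟩).1 i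
    have := hvα.1 i
    linarith
  have goal : y x ∈ (trunc hK (α.1.add (Box.integral
      (fun t => (v α).1.add (Box.smul (t - s) P)) s x))).1.toSet := by
    rw [Box.integral_add_smul _ _ hx]
    refine mem_trunc hK ⟨fun i => ?_, fun i => ?_⟩ (hyK x)
    · exact (add_le_add_left (hα.1 i) _).trans
        (add_affine_le_of_hasDerivWithinAt hx (hyi x le_rfl i) (hdown i))
    · exact (le_add_affine_of_hasDerivWithinAt hx (hyi x le_rfl i) (hup i)).trans
        (add_le_add_left (hα.2 i) _)
  exact goal

theorem mem_euler (hK : 0 ≤ K) (hM : 0 ≤ M) {f : (Fin n → ℝ) → Fin n → ℝ}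
    (hf : MapsTo f (cube (Fin n) K) (cube (Fin n) M))
    {v : IDom (Fin n) K → IDom (Fin n) M} {v' : IDom (Fin n) K → IDom (Fin n × Fin n) M₁}
    (hv : (v, v') ∈ V1f f) {D : (Fin n → ℝ) → Fin n × Fin n → ℝ}
    (hD : ∀ x ∈ cube (Fin n) K, lbar (cube (Fin n) K) f x = {D x})
    {y : ℝ → Fin n → ℝ} (hyK : ∀ t, y t ∈ cube (Fin n) K) (hy0 : y 0 = 0)
    (hy : ∀ t ∈ Icc 0 a, HasDerivWithinAt y (f (y t)) (Icc 0 a) t) (Q : Partition a)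
    (x : Icc (0 : ℝ) a) :
    y x ∈ (euler hK v v' Q x).1.toSet := by
  have h0 : y 0 ∈ (IDom.point (0 : Fin n → ℝ) (zero_mem_cube hK)).1.toSet := by
    rw [hy0]
    exact ⟨le_rfl, le_rfl⟩
  have node (i : Fin (Q.k + 1)) : y (Q.q i) ∈ (eulerNode hK v v' Q i).1.toSet := by
    induction i using Fin.induction with
    | zero => rw [Q.first]; exact h0
    | succ j ih =>
      exact mem_eulerStep hK hM hf hv hD hyK hy Q j ih
        (Q.strictMono Fin.castSucc_lt_succ).le le_rfl
  unfold euler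
  split_ifs with h
  · exact mem_eulerStep hK hM hf hv hD hyK hy Q _ (node _) h.choose_spec.1.le h.choose_spec.2
  -- The default branch is reached only at `x = 0`.
  · rcases x.2.1.eq_or_lt with hx | hx
    · rw [← hx]
      exact h0
    · exact absurd (Q.exists_mem_Ioc hx x.2.2) h

/-- The growth of the width in one step of the second-order Euler scheme. -/
theorem width_eulerStep_le [NeZero n] (hK : 0 ≤ K) (hM : 0 ≤ M) (hM₁ : 0 ≤ M₁) {N L C : ℝ}
    (hN : 0 ≤ N) (hL : 0 ≤ L) (hC : 0 ≤ C) {v : IDom (Fin n) K → IDom (Fin n) M}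
    {v' : IDom (Fin n) K → IDom (Fin n × Fin n) M₁} {Q : Partition a} (hQ : Q.mesh ≤ 1)
    (hv : ∀ α, (v α).1.width ≤ N * α.1.width + C * Q.mesh ^ 2)
    (hv' : ∀ α, (v' α).1.width ≤ L * α.1.width + C * Q.mesh ^ 2)
    (j : Fin Q.k) (α : IDom (Fin n) K) {x : ℝ} (hx : Q.q j.castSucc ≤ x)
    (hx' : x ≤ Q.q j.succ) :
    (eulerStep hK v v' Q j α x).1.width ≤ α.1.width +
      (x - Q.q j.castSucc) * ((N + n * (M₁ * N + M * L)) * α.1.width +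
        (C + n * (M₁ * N + M * L) * (2 * M) + n * (M₁ + M) * C) * Q.mesh ^ 2) := by
  set s := Q.q j.castSucc
  set E := Q.mesh
  set h := x - s
  have hh0 : 0 ≤ h := sub_nonneg.2 hx
  have hhE : h ≤ E := (sub_le_sub_right hx' s).trans (Q.step_le_mesh j)
  have hE0 : 0 ≤ E := hh0.trans hhE
  set A : IDom (Fin n) K := trunc hK (α.1.expand (M * Q.step j))
  set P := (v' A).1.mulVec (v A).1
  set w := α.1.width
  have hw0 : 0 ≤ w := α.1.width_nonneg
  have hAw : A.1.width ≤ w + 2 * M * E := by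
    refine (width_trunc_le hK _).trans (Box.width_le_iff.2 fun i => ?_)
    have h1 := Box.sub_le_width α.1 i
    have h2 := mul_le_mul_of_nonneg_left (Q.step_le_mesh j) hM
    simp only [Box.expand, abs_of_nonneg (mul_nonneg hM (Q.step_pos j).le)]
    linarith
  have hPw : P.width ≤ n * (M₁ * N + M * L) * (w + 2 * M * E) + n * (M₁ + M) * C * E ^ 2 := by
    have h1 := Box.width_mulVec_le hM₁ hM (v' A) (v A)
    rw [Fintype.card_fin] at h1
    calc P.width ≤ n * (M₁ * (v A).1.width + M * (v' A).1.width) := h1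
      _ ≤ n * (M₁ * (N * (w + 2 * M * E) + C * E ^ 2) +
          M * (L * (w + 2 * M * E) + C * E ^ 2)) := by
        gcongr
        · exact (hv A).trans (by gcongr)
        · exact (hv' A).trans (by gcongr)
      _ = _ := by ring
  have hstep : (trunc hK (α.1.add (Box.integral
      (fun t => (v α).1.add (Box.smul (t - s) P)) s x))).1.width ≤
      w + (h * (v α).1.width + h ^ 2 / 2 * P.width) := by
    rw [Box.integral_add_smul _ _ hx]
    refine (width_trunc_le hK _).trans (Box.width_le_iff.2 fun i => ?_)
    have h1 := Box.sub_le_width α.1 i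
    have h2 := mul_le_mul_of_nonneg_left (Box.sub_le_width (v α).1 i) hh0
    have h3 := mul_le_mul_of_nonneg_left (Box.sub_le_width P i)
      (by positivity : 0 ≤ h ^ 2 / 2)
    simp only [Box.add]
    linarith
  have hh1 : h ≤ 1 := hhE.trans hQ
  -- One factor `h` stays outside for summation over steps. The other is bounded by `E` on the term
  -- linear in `E`, making it quadratic, and by `1` elsewhere.
  have h2P : h / 2 * P.width ≤ n * (M₁ * N + M * L) * w +
      (n * (M₁ * N + M * L) * (2 * M) + n * (M₁ + M) * C) * E ^ 2 := by
    have hB : 0 ≤ n * (M₁ * N + M * L) := by positivity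
    have hB' : 0 ≤ n * (M₁ + M) * C * E ^ 2 := by positivity
    calc h / 2 * P.width ≤ h * P.width :=
          mul_le_mul_of_nonneg_right (by linarith) P.width_nonneg
      _ ≤ h * (n * (M₁ * N + M * L) * (w + 2 * M * E) + n * (M₁ + M) * C * E ^ 2) := by gcongr
      _ = h * (n * (M₁ * N + M * L) * w) + n * (M₁ * N + M * L) * (2 * M) * E * h +
          h * (n * (M₁ + M) * C * E ^ 2) := by ring
      _ ≤ 1 * (n * (M₁ * N + M * L) * w) + n * (M₁ * N + M * L) * (2 * M) * E * E +
          1 * (n * (M₁ + M) * C * E ^ 2) := by gcongr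
      _ = _ := by ring
  calc (eulerStep hK v v' Q j α x).1.width
      ≤ w + h * ((v α).1.width + h / 2 * P.width) := hstep.trans_eq (by ring)
    _ ≤ w + h * ((N * w + C * E ^ 2) + (n * (M₁ * N + M * L) * w +
          (n * (M₁ * N + M * L) * (2 * M) + n * (M₁ + M) * C) * E ^ 2)) := by
      gcongr
      exact hv α
    _ = _ := by ring

/-- The widths of the second-order Euler enclosures are quadratic in the mesh. -/
theorem width_euler_le [NeZero n] (hK : 0 ≤ K) (ha : 0 ≤ a)
    {v : IDom (Fin n) K → IDom (Fin n) M}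
    {v' : IDom (Fin n) K → IDom (Fin n × Fin n) M₁} {Q : Partition a} {c d : ℝ} (hc : 0 ≤ c)
    (hd : 0 ≤ d)
    (hstep : ∀ (j : Fin Q.k) (α : IDom (Fin n) K) (x : ℝ), Q.q j.castSucc ≤ x → x ≤ Q.q j.succ →
      (eulerStep hK v v' Q j α x).1.width ≤
        α.1.width + (x - Q.q j.castSucc) * (c * α.1.width + d))
    (x : Icc (0 : ℝ) a) :
    (euler hK v v' Q x).1.width ≤ a * Real.exp (c * a) * d := by
  -- Discrete Grönwall: the profile `t * exp (c t) * d` dominates the recursion because `1 + c h ≤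
  -- exp (c h)`, whatever the number of nodes.
  have grow {s x w : ℝ} (hs : 0 ≤ s) (hsx : s ≤ x) (hw : w ≤ s * Real.exp (c * s) * d) :
      w + (x - s) * (c * w + d) ≤ x * Real.exp (c * x) * d := by
    have h0 : 0 ≤ x - s := sub_nonneg.2 hsx
    have h1 : 1 + c * (x - s) ≤ Real.exp (c * (x - s)) := by
      linarith [Real.add_one_le_exp (c * (x - s))]
    have h2 : 1 ≤ Real.exp (c * x) := Real.one_le_exp (mul_nonneg hc (hs.trans hsx))
    calc w + (x - s) * (c * w + d) = (1 + c * (x - s)) * w + (x - s) * 1 * d := by ring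
      _ ≤ (1 + c * (x - s)) * (s * Real.exp (c * s) * d) + (x - s) * Real.exp (c * x) * d := by
        gcongr
      _ ≤ Real.exp (c * (x - s)) * (s * Real.exp (c * s) * d) +
          (x - s) * Real.exp (c * x) * d := by gcongr
      _ = x * Real.exp (c * x) * d := by
        rw [show c * x = c * (x - s) + c * s by ring, Real.exp_add]
        ring
  have node (i : Fin (Q.k + 1)) :
      (eulerNode hK v v' Q i).1.width ≤ Q.q i * Real.exp (c * Q.q i) * d := by
    induction i using Fin.induction with
    | zero =>
      rw [Q.first]
      exact (Box.width_point _).trans_le (by simp)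
    | succ j ih =>
      have hle := (Q.strictMono (Fin.castSucc_lt_succ (i := j))).le
      exact (hstep j _ _ hle le_rfl).trans (grow (Q.q_nonneg _) hle ih)
  unfold euler
  split_ifs with h
  · refine (hstep _ _ _ h.choose_spec.1.le h.choose_spec.2).trans
      ((grow (Q.q_nonneg _) h.choose_spec.1.le (node _)).trans ?_)
    have hx0 := x.2.1
    have hxa := x.2.2
    gcongr
  · exact (Box.width_point _).trans_le (by positivity)

/-- Enclosures of a curve whose widths tend to zero have the curve as their least upper bound. -/
theorem isLUB_range_of_width_tendsto_zero {X ι : Type} [Finite ι] {R : ℝ}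
    {F : ℕ → X → IDom ι R} {y : X → ι → ℝ} (hy : ∀ x, y x ∈ cube ι R)
    (hmem : ∀ k x, y x ∈ (F k x).1.toSet)
    (hF : ∀ x, Tendsto (fun k => (F k x).1.width) atTop (𝓝 0)) :
    IsLUB (range F) (fun x => IDom.point (y x) (hy x)) := by
  constructor
  · rintro _ ⟨k, rfl⟩ x
    -- Membership in a box and lying above it as a point unfold to the same two inequalities.
    exact hmem k x
  -- An upper bound lies inside every enclosure, together with `y x`, so the vanishing widths
  -- squeeze its end-points to `y x`.
  · intro z hz x
    have hle (k : ℕ) : (F k x).1 ≤ (z x).1 := hz (mem_range_self k) x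
    refine ⟨fun i => ?_, fun i => ?_⟩
    · refine le_of_tendsto_of_tendsto' ((hF x).const_sub (y x i)) tendsto_const_nhds
        (fun k => ?_) |>.trans' (by simp [IDom.point, Box.point])
      linarith [(F k x).1.sub_le_width i, (hmem k x).2 i, (hle k).1 i]
    · refine (le_of_tendsto_of_tendsto' tendsto_const_nhds ((hF x).const_add (y x i))
        (fun k => ?_)).trans (by simp [IDom.point, Box.point])
      linarith [(F k x).1.sub_le_width i, (hmem k x).1 i, (hle k).2 i]

end Euler

/-- If the derivative has an interval extension of width zero at points, it is point-valued. -/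
theorem exists_lbar_eq_singleton {n : ℕ} {K M M₁ : ℝ} {f : (Fin n → ℝ) → Fin n → ℝ}
    {u : IDom (Fin n) K → IDom (Fin n) M} {u' : IDom (Fin n) K → IDom (Fin n × Fin n) M₁}
    (hext : IsExtension f u u') (hu' : IntervalLipschitz u') :
    ∃ D : (Fin n → ℝ) → Fin n × Fin n → ℝ,
      ∀ x ∈ cube (Fin n) K, lbar (cube (Fin n) K) f x = {D x} := by
  obtain ⟨L, -, hL⟩ := hu'
  suffices h : ∀ x ∈ cube (Fin n) K, ∃ d, lbar (cube (Fin n) K) f x = {d} by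
    choose! D hD using h
    exact ⟨D, hD⟩
  intro x hx
  have hw := hL (IDom.point x hx)
  rw [show (IDom.point x hx).1.width = 0 from Box.width_point x, mul_zero] at hw
  refine ⟨(u' (IDom.point x hx)).1.lo, ?_⟩
  rw [← (hext x hx).2, Box.toSet, ← Icc_self]
  congr 1
  ext i
  have := Box.sub_le_width (u' (IDom.point x hx)).1 i
  exact le_antisymm (by linarith) (Box.lo_le_hi _ i)

end IntervalEuler

/-! ### Quadratic accuracy and convergence to the solution -/

theorem mainTheorem6 (n : ℕ) (hn : 1 ≤ n) (K M M₁ a : ℝ) (hK : 0 < K) (hM : 0 < M)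
    (hM₁ : 0 ≤ M₁) (ha : 0 < a) (haK : a ≤ K / (M * (1 + n * M₁)))
    -- the vector field
    (f : (Fin n → ℝ) → (Fin n → ℝ))
    (hf : Set.MapsTo f (cube (Fin n) K) (cube (Fin n) M))
    (hfLip : ∃ L : NNReal, LipschitzOnWith L f (cube (Fin n) K))
    -- the interval extensions of the field and its derivative
    (u : IDom (Fin n) K → IDom (Fin n) M) (u' : IDom (Fin n) K → IDom (Fin n × Fin n) M₁)
    (hu : (u, u') ∈ V1f f) (hext : IsExtension f u u')
    (hwidth : ∀ α, (u α).1.width ≤ (u' α).1.normInf * α.1.width)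
    (hu'Lip : IntervalLipschitz u')
    -- the partitions
    (Q : ℕ → Partition a) (hQ₁ : ∀ k, (Q k).mesh ≤ 1)
    (hQ : Filter.Tendsto (fun k => (Q k).mesh) Filter.atTop (nhds 0))
    -- the approximations of the field
    (v : ℕ → IDom (Fin n) K → IDom (Fin n) M)
    (v' : ℕ → IDom (Fin n) K → IDom (Fin n × Fin n) M₁)
    (hv : ∀ k, (v k, v' k) ∈ V1f f)
    (hsup : IsLUB (Set.range fun k => (v k, v' k)) (u, u'))
    (C₁ : ℝ) (hC₁ : 0 < C₁)
    (hd : ∀ k, funDist (v k) u ≤ ENNReal.ofReal (C₁ * (Q k).mesh ^ 2))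
    (hd' : ∀ k, funDist (v' k) u' ≤ ENNReal.ofReal (C₁ * (Q k).mesh ^ 2)) :
    (∃ C₂ : ℝ, 0 ≤ C₂ ∧ ∀ k,
      funWidth (euler hK.le (v k) (v' k) (Q k)) ≤ ENNReal.ofReal (C₂ * (Q k).mesh ^ 2)) ∧
    ∃ (y : ℝ → (Fin n → ℝ)) (hy : ∀ x : Set.Icc (0 : ℝ) a, y x ∈ cube (Fin n) K),
      IsLUB (Set.range fun k => euler hK.le (v k) (v' k) (Q k))
        (fun x => IDom.point (y x) (hy x)) ∧
      y 0 = 0 ∧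
      ∀ t ∈ Set.Icc (0 : ℝ) a, HasDerivWithinAt y (f (y t)) (Set.Icc 0 a) t := by
  have : NeZero n := ⟨by omega⟩
  obtain ⟨D, hD⟩ := exists_lbar_eq_singleton hext hu'Lip
  have hMa : M * a ≤ K := by
    have h1 : 1 ≤ 1 + n * M₁ := le_add_of_nonneg_right (by positivity)
    rw [le_div_iff₀ (by positivity)] at haK
    calc M * a = a * (M * 1) := by ring
      _ ≤ a * (M * (1 + n * M₁)) := by gcongr
      _ ≤ K := haK
  obtain ⟨y, hyK, hy0, hy⟩ := exists_solution_mem_cube hK.le hM.le ha.le hMa hf hfLip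
  obtain ⟨L, hL, hu'L⟩ := hu'Lip
  have hN : 0 ≤ n * M₁ := by positivity
  -- Moving both end-points by at most `C₁ |Q|²` changes a width by at most twice that, whence `2 *
  -- C₁`.
  have hwv (k : ℕ) (α : IDom (Fin n) K) :
      (v k α).1.width ≤ n * M₁ * α.1.width + 2 * C₁ * (Q k).mesh ^ 2 := by
    have h1 := Box.width_le_add_dist (v k α).1 (u α).1
    have h2 := dist_le_of_funDist_le (by positivity) (hd k) α
    have h3 := mul_le_mul_of_nonneg_right (Box.normInf_le (u' α)) α.1.width_nonneg
    rw [Fintype.card_fin] at h3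
    linarith [hwidth α]
  have hwv' (k : ℕ) (α : IDom (Fin n) K) :
      (v' k α).1.width ≤ L * α.1.width + 2 * C₁ * (Q k).mesh ^ 2 := by
    have h1 := Box.width_le_add_dist (v' k α).1 (u' α).1
    have h2 := dist_le_of_funDist_le (by positivity) (hd' k) α
    linarith [hu'L α]
  obtain ⟨C₂, hC₂, hw⟩ : ∃ C₂ : ℝ, 0 ≤ C₂ ∧ ∀ k x,
      (euler hK.le (v k) (v' k) (Q k) x).1.width ≤ C₂ * (Q k).mesh ^ 2 := by
    -- These are the coefficients of `width_eulerStep_le` for `N = n * M₁` and `C = 2 * C₁`, with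
    -- `|Q|²` factored out of `d`.
    set c : ℝ := n * M₁ + n * (M₁ * (n * M₁) + M * L)
    set d : ℝ := 2 * C₁ + n * (M₁ * (n * M₁) + M * L) * (2 * M) + n * (M₁ + M) * (2 * C₁)
    have hc : 0 ≤ c := by positivity
    have hd0 : 0 ≤ d := by positivity
    refine ⟨a * Real.exp (c * a) * d, by positivity, fun k x => ?_⟩
    rw [mul_assoc]
    exact width_euler_le hK.le ha.le hc (by positivity) (fun j α x hx hx' =>
      width_eulerStep_le hK.le hM.le hM₁ hN hL (by positivity) (hQ₁ k) (hwv k) (hwv' k)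
        j α hx hx') x
  refine ⟨⟨C₂, hC₂, fun k => iSup_le fun x => ENNReal.ofReal_le_ofReal (hw k x)⟩,
    y, fun x => hyK x, ?_, hy0, hy⟩
  refine isLUB_range_of_width_tendsto_zero _
    (fun k x => mem_euler hK.le hM.le hf (hv k) hD hyK hy0 hy (Q k) x) fun x => ?_
  have hlim : Filter.Tendsto (fun k => C₂ * (Q k).mesh ^ 2) Filter.atTop (nhds 0) := by
    simpa using (hQ.pow 2).const_mul C₂
  exact squeeze_zero (fun k => Box.width_nonneg _) (fun k => hw k x) hlim
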